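/- Let $\mathbb R_+=[0,\infty)$ and let $X=\{X(\mathbf t),\ \mathbf t\in\mathbb R_+^2\}$ be a separable centered Gaussian random field with $\mathbf E X^2(1,1)=1$ which is self-similar with index $(H_1,H_2)\in(0,1)^2$, i.e. $\{X(a_1t_1,a_2t_2)\}_{\mathbf t\in\mathbb R_+^2}$ and $\{a_1^{H_1}a_2^{H_2}X(\mathbf t)\}_{\mathbf t\in\mathbb R_+^2}$ have the same finite-dimensional distributions for all $a_1,a_2>0$, and which has stationary rectangular increments, i.e. for every $\mathbf u\in\mathbb R_+^2$ the fields $\{\Delta_{\mathbf u}X(\mathbf u+\mathbf h)\}_{\mathbf h\in\mathbb R_+^2}$ and $\{\Delta_{\mathbf 0}X(\mathbf h)\}_{\mathbf h\in\mathbb R_+^2}$ have the same finite-dimensional distributions, where $\Delta_{\mathbf u}X(\mathbf v)=X(v_1,v_2)-X(u_1,v_2)-X(v_1,u_2)+X(u_1,u_2)$. Put $H=\min\{H_1,H_2\}$. Let $c:(0,\infty)\to(0,\infty)$ be nondecreasing on $[1,\infty)$ with $c(t)\to\infty$ as $t\to\infty$ and $c(1/t)=c(t)$ for $t\ge1$.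 Let $(b_k)_{k\ge0}$ satisfy $b_0=1$, $b_k<b_{k+1}$ for all $k\ge0$, $b_k\to\infty$, and $$M:=\inf_{k\ge0}\Big(\frac{b_k}{b_{k+1}}\Big)^{H_1+H_2}c(b_k)>0 .$$ Put $$u=\frac{3}{4^{1-H}+3}\cdot\frac{M^2}{4},\qquad v_k=\frac{2}{M^2}\left(\Big(\frac{b_k}{b_{k+1}}\Big)^{H_1+H_2}c(b_k)\right)^2,\quad k\ge0,$$ and assume that the series $\sum_{k=0}^\infty v_k^{2/H}e^{-v_k}$ converges. Then for every $\varepsilon>\frac{2}{M}\sqrt{\frac23\left(4^{1-H}+3\right)}$, $$\mathbf P\left\{\sup_{\mathbf t\in\mathbb R_+^2\setminus\{\mathbf 0\}}\frac{|X(\mathbf t)|}{(t_1\vee t_2)^{H_1+H_2}\,c(t_1\vee t_2)}>\varepsilon\right\}\le 16\sqrt2\left(\frac e2\right)^{2/H}\varepsilon^{4/H}\left(\sum_{k=0}^\infty v_k^{2/H}e^{-v_k}\right)M^{4/H}e^{-u\varepsilon^2}.$$ -/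

import Mathlib

open MeasureTheory ProbabilityTheory Filter Topology
open scoped NNReal ENNReal

/-- Two real random fields on the same index set have the same finite-dimensional distributions. -/
def EqFinDimDistrib {Ω T : Type*} [MeasurableSpace Ω] (P : Measure Ω) (X Y : T → Ω → ℝ) : Prop :=
  ∀ I : Finset T,
    IdentDistrib (fun ω (i : I) => X i ω) (fun ω (i : I) => Y i ω) P P

/-- A field on the quadrant `ℝ₊²` is self-similar with index `(H₁, H₂)`. -/
def IsSelfSimilarField {Ω : Type*} [MeasurableSpace Ω] (P : Measure Ω)
    (X : ℝ≥0 × ℝ≥0 → Ω → ℝ) (H₁ H₂ : ℝ) : Prop :=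
  ∀ a₁ a₂ : ℝ≥0, 0 < a₁ → 0 < a₂ →
    EqFinDimDistrib P (fun t ω => X (a₁ * t.1, a₂ * t.2) ω)
      (fun t ω => (a₁ : ℝ) ^ H₁ * (a₂ : ℝ) ^ H₂ * X t ω)

/-- The rectangular increment `Δ_u X(v)`. -/
def rectIncrement {Ω : Type*} (X : ℝ≥0 × ℝ≥0 → Ω → ℝ) (u v : ℝ≥0 × ℝ≥0) (ω : Ω) : ℝ :=
  X (v.1, v.2) ω - X (u.1, v.2) ω - X (v.1, u.2) ω + X (u.1, u.2) ω

/-- For every `u`, the fields `h ↦ Δ_u X(u + h)` and `h ↦ Δ_0 X(h)` have the same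
finite-dimensional distributions. -/
def HasStationaryRectIncrements {Ω : Type*} [MeasurableSpace Ω] (P : Measure Ω)
    (X : ℝ≥0 × ℝ≥0 → Ω → ℝ) : Prop :=
  ∀ u : ℝ≥0 × ℝ≥0,
    EqFinDimDistrib P (fun h ω => rectIncrement X u (u + h) ω)
      (fun h ω => rectIncrement X 0 h ω)

/-- Separability in the sense of Doob: outside one null set, membership of the values of the field
in a closed set on an open set of parameters can be tested on a countable dense set. -/
def IsSeparableField {Ω T : Type*} [MeasurableSpace Ω] [TopologicalSpace T] (P : Measure Ω)
    (X : T → Ω → ℝ) : Prop :=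
  ∃ S : Set T, S.Countable ∧ Dense S ∧ ∃ N : Set Ω, P N = 0 ∧
    ∀ G : Set T, IsOpen G → ∀ F : Set ℝ, IsClosed F →
      {ω | ∀ t ∈ G ∩ S, X t ω ∈ F} \ {ω | ∀ t ∈ G, X t ω ∈ F} ⊆ N

/-- The supremum, in the extended reals, of `|X(t)| / ((t₁ ∨ t₂)^(H₁+H₂) c(t₁ ∨ t₂))` over
`t ∈ ℝ₊²`, `t ≠ 0` (the quotient is not defined at the origin). -/
noncomputable def normalizedSup {Ω : Type*} (X : ℝ≥0 × ℝ≥0 → Ω → ℝ) (H₁ H₂ : ℝ) (c : ℝ → ℝ)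
    (ω : Ω) : EReal :=
  ⨆ t : {t : ℝ≥0 × ℝ≥0 // t ≠ 0},
    ((|X t.1 ω| / ((max t.1.1 t.1.2 : ℝ) ^ (H₁ + H₂) * c (max t.1.1 t.1.2 : ℝ)) : ℝ) : EReal)

/-- `(b_k / b_{k+1})^(H₁+H₂) c(b_k)`. -/
noncomputable def levelRatio (H₁ H₂ : ℝ) (c : ℝ → ℝ) (b : ℕ → ℝ) (k : ℕ) : ℝ :=
  (b k / b (k + 1)) ^ (H₁ + H₂) * c (b k)

/-! The quadrant minus the origin is cut into shells according to `t₁ ∨ t₂`: between `b k` and `b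
(k+1)`, and between the reciprocals of these numbers. On either shell the weight is at least
`levelRatio k` times `T ^ (H₁ + H₂)`, with `T` the side of a square containing the shell. So an
exceedance of `ε` forces `|X|` above `x * T ^ (H₁ + H₂)` on `[0,T)²`, with `x = ε * levelRatio k`.
Two shells per `k` turn the constant `8√2` for one square into `16√2`.

For one square, second moments suffice. Self-similarity gives `E X(t)² = (t₁^H₁ t₂^H₂)²`, so `X`
vanishes a.s. on the axes, and stationarity of rectangular increments then controls one-coordinate
increments. After normalization to the unit square the variance is at most 1 and increments over
distance `δ` have second moment at most `4 δ^(2H)`. Chaining on nested grids, the coarsest with at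
most `(e x²)^(2/H)` points, yields the tail (`measure_exists_lt_abs_le`). The target exponent
`3x²/(2a)` with `a > 4` is below `3x²/8`, weaker than the Gaussian `x²/2`; this slack pays for the
chaining.

Finally, the exponent equals `v k * (u ε²)` with both factors at least 2, so it dominates `v k + u
ε²` and the sum over `k` separates from `ε` (`tail_term_le`). -/

/-! ### Gaussian tails and chaining along nested grids. -/

/-- Two-sided Chernoff bound for a centered Gaussian variable with second moment at most `s`. -/
lemma measure_lt_abs_le_of_hasGaussianLaw {Ω : Type*} [MeasurableSpace Ω] {P : Measure Ω}
    [IsProbabilityMeasure P] {Z : Ω → ℝ} (hZ : HasGaussianLaw Z P) (h0 : ∫ ω, Z ω ∂P = 0)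
    {s r : ℝ} (hs : ∫ ω, Z ω ^ 2 ∂P ≤ s) (hr : 0 ≤ r) :
    P {ω | r < |Z ω|} ≤ ENNReal.ofReal (2 * Real.exp (-r ^ 2 / (2 * s))) := by
  have hs0 : 0 ≤ s := (integral_nonneg fun ω => sq_nonneg (Z ω)).trans hs
  have key : ∀ W : Ω → ℝ, HasGaussianLaw W P → ∫ ω, W ω ∂P = 0 → ∫ ω, W ω ^ 2 ∂P ≤ s →
      HasSubgaussianMGF W s.toNNReal P := by
    intro W hW hW0 hWs
    have hmap := hW.map_eq_gaussianReal
    have hvar : Var[W; P] = ∫ ω, W ω ^ 2 ∂P := by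
      rw [variance_of_integral_eq_zero hW.aemeasurable hW0]
    rw [hW0, hvar] at hmap
    refine ⟨fun t => ?_, fun t => ?_⟩
    · have := integrable_exp_mul_gaussianReal (μ := 0) (v := (∫ ω, W ω ^ 2 ∂P).toNNReal) t
      rw [← hmap] at this
      exact this.comp_aemeasurable hW.aemeasurable
    · rw [mgf_gaussianReal hmap, zero_mul, zero_add, Real.exp_le_exp]
      have : (0 : ℝ) ≤ ∫ ω, W ω ^ 2 ∂P := integral_nonneg fun ω => sq_nonneg (W ω)
      rw [Real.coe_toNNReal _ this, Real.coe_toNNReal _ hs0]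
      gcongr
  have h1 := (key Z hZ h0 hs).measure_ge_le hr
  have h2 := (key (fun ω => -Z ω) hZ.fun_neg (by rw [integral_neg, h0, neg_zero])
    (by simpa using hs)).measure_ge_le hr
  rw [Real.coe_toNNReal _ hs0] at h1 h2
  calc P {ω | r < |Z ω|} ≤ P ({ω | r ≤ Z ω} ∪ {ω | r ≤ -Z ω}) := by
        refine measure_mono fun ω hω => ?_
        rcases lt_abs.1 (show r < |Z ω| from hω) with h | h
        · exact Or.inl h.le
        · exact Or.inr h.le
    _ ≤ P {ω | r ≤ Z ω} + P {ω | r ≤ -Z ω} := measure_union_le _ _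
    _ ≤ ENNReal.ofReal (Real.exp (-r ^ 2 / (2 * s))) +
          ENNReal.ofReal (Real.exp (-r ^ 2 / (2 * s))) := by
        gcongr
        · rw [← ofReal_measureReal]; exact ENNReal.ofReal_le_ofReal h1
        · rw [← ofReal_measureReal]; exact ENNReal.ofReal_le_ofReal h2
    _ = _ := by rw [← ENNReal.ofReal_add (by positivity) (by positivity), ← two_mul]

/-- The lower left corner of the cell of the grid of mesh `1 / m` that contains `t`. -/
noncomputable def gridFloor (m : ℕ) (t : ℝ≥0 × ℝ≥0) : ℝ≥0 × ℝ≥0 :=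
  ((⌊m * t.1⌋₊ : ℝ≥0) / m, (⌊m * t.2⌋₊ : ℝ≥0) / m)

lemma floor_mul_div_le (m : ℕ) (s : ℝ≥0) : (⌊m * s⌋₊ : ℝ≥0) / m ≤ s := by
  rcases Nat.eq_zero_or_pos m with rfl | hm
  · simp
  · rw [div_le_iff₀ (by positivity), mul_comm]
    exact Nat.floor_le (by positivity)

lemma sub_floor_mul_div_le {m : ℕ} (hm : 0 < m) (s : ℝ≥0) :
    (s : ℝ) - ((⌊m * s⌋₊ : ℝ≥0) / m : ℝ≥0) ≤ 1 / m := by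
  have h : (m * s : ℝ≥0) < ⌊m * s⌋₊ + 1 := Nat.lt_floor_add_one _
  have h' : (m : ℝ) * s < ⌊m * s⌋₊ + 1 := by exact_mod_cast h
  have hm' : (0 : ℝ) < m := by positivity
  push_cast
  rw [sub_le_iff_le_add, ← add_div, le_div_iff₀ hm']
  linarith

lemma floor_mul_lt {m : ℕ} (hm : 0 < m) {s : ℝ≥0} (hs : s < 1) : ⌊m * s⌋₊ < m := by
  rw [Nat.floor_lt (by positivity)]
  have : (0 : ℝ≥0) < m := by exact_mod_cast hm
  calc (m : ℝ≥0) * s < m * 1 := by gcongr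
    _ = m := mul_one _

/-- Passing from a cell of the fine grid to its parent is integer division of the indices by `q`;
this links `gridFloor` at consecutive levels. -/
lemma floor_mul_eq_div {m q : ℕ} (hq : 0 < q) (s : ℝ≥0) :
    ⌊m * s⌋₊ = ⌊((m * q : ℕ) : ℝ≥0) * s⌋₊ / q := by
  rw [← Nat.floor_div_natCast]
  congr 1
  have : (q : ℝ≥0) ≠ 0 := by positivity
  push_cast
  field_simp

/-- Union bound along nested grids: a Gaussian field on `[0,1)²` exceeds the level `x` on a
countable set only if it exceeds `x - R` on the coarsest grid, or one of its increments between
consecutive grids exceeds its threshold. -/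
lemma measure_exists_lt_abs_le_of_grids {Ω : Type*} [MeasurableSpace Ω] {P : Measure Ω}
    [IsProbabilityMeasure P] {Y : ℝ≥0 × ℝ≥0 → Ω → ℝ} (hY : IsGaussianProcess Y P)
    (hcent : ∀ t, ∫ ω, Y t ω ∂P = 0)
    (hvar : ∀ t : ℝ≥0 × ℝ≥0, t.1 < 1 → t.2 < 1 → ∫ ω, Y t ω ^ 2 ∂P ≤ 1)
    {m : ℕ → ℕ} {q : ℕ} (hm : ∀ n, 0 < m n) (hq : 0 < q) (hmq : ∀ n, m (n + 1) = m n * q)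
    {D r : ℕ → ℝ} {R x : ℝ} (hD0 : ∀ n, 0 < D n) (hDlim : Tendsto D atTop (𝓝 0))
    (hD : ∀ n, ∀ s t : ℝ≥0 × ℝ≥0, t.1 < 1 → t.2 < 1 → s.1 ≤ t.1 → s.2 ≤ t.2 →
      (t.1 : ℝ) - s.1 ≤ 1 / m n → (t.2 : ℝ) - s.2 ≤ 1 / m n →
      ∫ ω, (Y t ω - Y s ω) ^ 2 ∂P ≤ D n)
    (hr : ∀ n, 0 ≤ r n) (hrR : ∀ n, ∑ k ∈ Finset.range n, r k ≤ R) (hRx : R ≤ x)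
    {S : Set (ℝ≥0 × ℝ≥0)} (hS : S.Countable) :
    P {ω | ∃ t ∈ S, t.1 < 1 ∧ t.2 < 1 ∧ x < |Y t ω|} ≤
      ENNReal.ofReal ((m 0 : ℝ) ^ 2 * (2 * Real.exp (-(x - R) ^ 2 / (2 * 1)))) +
      ∑' n, ENNReal.ofReal ((m (n + 1) : ℝ) ^ 2 * (2 * Real.exp (-(r n) ^ 2 / (2 * D n)))) := by
  set g : ℕ → ℕ × ℕ → ℝ≥0 × ℝ≥0 := fun n i => ((i.1 : ℝ≥0) / m n, (i.2 : ℝ≥0) / m n) with hg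
  set I : ℕ → Finset (ℕ × ℕ) := fun n => Finset.range (m n) ×ˢ Finset.range (m n) with hI
  have hgmono : ∀ n (s : ℝ≥0) (i : ℕ), i < m n → ((i : ℝ≥0) / m n) < 1 := by
    intro n s i hi
    rw [div_lt_one (by exact_mod_cast hm n)]
    exact_mod_cast hi
  set B0 : Set Ω := ⋃ i ∈ I 0, {ω | x - R < |Y (g 0 i) ω|} with hB0
  set B : ℕ → Set Ω := fun n => ⋃ i ∈ I (n + 1),
    {ω | r n < |Y (g (n + 1) i) ω - Y (g n (i.1 / q, i.2 / q)) ω|} with hB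
  have hgauss : ∀ s t, HasGaussianLaw (fun ω => Y t ω - Y s ω) P := fun s t =>
    hY.hasGaussianLaw_fun_sub
  have hgc : ∀ s t, ∫ ω, (Y t ω - Y s ω) ∂P = 0 := fun s t => by
    rw [integral_sub (hY.hasGaussianLaw_eval t).integrable (hY.hasGaussianLaw_eval s).integrable,
      hcent, hcent, sub_zero]
  have hcard : ∀ n, (I n).card = m n ^ 2 := fun n => by simp [hI, sq]
  have hunion : ∀ (n : ℕ) (A : ℕ × ℕ → Set Ω) (p : ℝ), 0 ≤ p →
      (∀ i ∈ I n, P (A i) ≤ ENNReal.ofReal p) →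
      P (⋃ i ∈ I n, A i) ≤ ENNReal.ofReal ((m n : ℝ) ^ 2 * p) := by
    intro n A p hp hA
    calc P (⋃ i ∈ I n, A i) ≤ ∑ i ∈ I n, P (A i) := measure_biUnion_finset_le _ _
      _ ≤ ∑ i ∈ I n, ENNReal.ofReal p := Finset.sum_le_sum hA
      _ = _ := by
        rw [Finset.sum_const, hcard, nsmul_eq_mul, ENNReal.ofReal_mul (by positivity)]
        congr 1
        rw [← Nat.cast_pow, ENNReal.ofReal_natCast]
  have hPB0 : P B0 ≤
      ENNReal.ofReal ((m 0 : ℝ) ^ 2 * (2 * Real.exp (-(x - R) ^ 2 / (2 * 1)))) := by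
    refine hunion 0 _ _ (by positivity) fun i hi => ?_
    simp only [hI, Finset.mem_product, Finset.mem_range] at hi
    exact measure_lt_abs_le_of_hasGaussianLaw (hY.hasGaussianLaw_eval _) (hcent _)
      (hvar _ (hgmono 0 0 _ hi.1) (hgmono 0 0 _ hi.2)) (by linarith)
  have hstep : ∀ n i, ((i / q : ℕ) : ℝ≥0) / m n ≤ (i : ℝ≥0) / m (n + 1) ∧
      (((i : ℝ≥0) / m (n + 1) : ℝ≥0) : ℝ) - (((i / q : ℕ) : ℝ≥0) / m n : ℝ≥0) ≤ 1 / m n := by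
    intro n i
    have hmn : (m n : ℝ≥0) ≠ 0 := by exact_mod_cast (hm n).ne'
    have hq' : (q : ℝ≥0) ≠ 0 := by exact_mod_cast hq.ne'
    -- The parent of a fine grid point is its own `gridFloor` at the coarser level, so the mesh
    -- bounds apply.
    have e : i / q = ⌊m n * ((i : ℝ≥0) / m (n + 1))⌋₊ := by
      rw [floor_mul_eq_div hq, ← hmq, mul_div_cancel₀, Nat.floor_natCast]
      exact_mod_cast (hm (n + 1)).ne'
    rw [e]
    exact ⟨floor_mul_div_le _ _, sub_floor_mul_div_le (hm n) _⟩
  have hPB : ∀ n, P (B n) ≤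
      ENNReal.ofReal ((m (n + 1) : ℝ) ^ 2 * (2 * Real.exp (-(r n) ^ 2 / (2 * D n)))) := by
    intro n
    refine hunion (n + 1) _ _ (by positivity) fun i hi => ?_
    simp only [hI, Finset.mem_product, Finset.mem_range] at hi
    exact measure_lt_abs_le_of_hasGaussianLaw (hgauss _ _) (hgc _ _)
      (hD n _ _ (hgmono _ 0 _ hi.1) (hgmono _ 0 _ hi.2) (hstep n i.1).1 (hstep n i.2).1
        (hstep n i.1).2 (hstep n i.2).2) (hr n)
  set Bad : Set Ω := B0 ∪ ⋃ n, B n with hBad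
  have hgood : ∀ ω ∉ Bad, ∀ t : ℝ≥0 × ℝ≥0, t.1 < 1 → t.2 < 1 → ∀ n,
      |Y (gridFloor (m n) t) ω| ≤ x := by
    intro ω hω t ht1 ht2 n
    simp only [hBad, hB0, hB, Set.mem_union, Set.mem_iUnion, not_or, not_exists,
      Set.mem_ofPred_eq, not_lt] at hω
    have hmem : ∀ n, (⌊m n * t.1⌋₊, ⌊m n * t.2⌋₊) ∈ I n := fun n => by
      simp only [hI, Finset.mem_product, Finset.mem_range]
      exact ⟨floor_mul_lt (hm n) ht1, floor_mul_lt (hm n) ht2⟩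
    have h : ∀ n, |Y (gridFloor (m n) t) ω| ≤ x - R + ∑ k ∈ Finset.range n, r k := by
      intro n
      induction n with
      | zero =>
        rw [Finset.range_zero, Finset.sum_empty, add_zero]
        exact hω.1 _ (hmem 0)
      | succ n ih =>
        have h2 := hω.2 n _ (hmem (n + 1))
        simp only [hmq, ← floor_mul_eq_div hq, hg] at h2
        rw [Finset.sum_range_succ]
        have h3 : Y (gridFloor (m (n + 1)) t) ω = Y (gridFloor (m n) t) ω +
            (Y (gridFloor (m (n + 1)) t) ω - Y (gridFloor (m n) t) ω) := by ring
        rw [h3]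
        refine (abs_add_le _ _).trans ?_
        have h4 : |Y (gridFloor (m (n + 1)) t) ω - Y (gridFloor (m n) t) ω| ≤ r n := by
          simpa only [gridFloor, hmq] using h2
        linarith
    linarith [h n, hrR n]
  -- Convergence in probability of the grid approximations replaces path continuity: off `Bad` they
  -- stay below `x`, so `|Y t| > x + η` needs an increment above `η`, whose probability tends to 0
  -- with `D n`. The exceptional null set depends on `t`, hence the countable `S`.
  have hnull : ∀ t : ℝ≥0 × ℝ≥0, t.1 < 1 → t.2 < 1 → P (Badᶜ ∩ {ω | x < |Y t ω|}) = 0 := by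
    intro t ht1 ht2
    have hsub : Badᶜ ∩ {ω | x < |Y t ω|} ⊆
        ⋃ k : ℕ, Badᶜ ∩ {ω | x + 1 / ((k : ℝ) + 1) < |Y t ω|} := by
      rintro ω ⟨hω, hx⟩
      obtain ⟨k, hk⟩ := exists_nat_one_div_lt (sub_pos.2 (show x < |Y t ω| from hx))
      exact Set.mem_iUnion.2 ⟨k, hω, by simp only [Set.mem_ofPred_eq]; linarith⟩
    refine measure_mono_null hsub (measure_iUnion_null fun k => ?_)
    set η : ℝ := 1 / ((k : ℝ) + 1) with hη
    have hη0 : 0 < η := by positivity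
    have hle : ∀ n, P (Badᶜ ∩ {ω | x + η < |Y t ω|}) ≤
        ENNReal.ofReal (2 * Real.exp (-η ^ 2 / (2 * D n))) := by
      intro n
      refine le_trans (measure_mono ?_) (measure_lt_abs_le_of_hasGaussianLaw
        (hgauss (gridFloor (m n) t) t) (hgc _ _)
        (hD n (gridFloor (m n) t) t ht1 ht2 (floor_mul_div_le _ _) (floor_mul_div_le _ _)
          (sub_floor_mul_div_le (hm n) _) (sub_floor_mul_div_le (hm n) _)) hη0.le)
      rintro ω ⟨hω, hx⟩
      have h1 := hgood ω hω t ht1 ht2 n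
      have h2 : x + η < |Y t ω| := hx
      have h3 := abs_sub_abs_le_abs_sub (Y t ω) (Y (gridFloor (m n) t) ω)
      simp only [Set.mem_ofPred_eq]
      linarith
    have hlim : Tendsto (fun n => ENNReal.ofReal (2 * Real.exp (-η ^ 2 / (2 * D n)))) atTop
        (𝓝 0) := by
      rw [← ENNReal.ofReal_zero]
      refine ENNReal.tendsto_ofReal ?_
      rw [← mul_zero (2 : ℝ)]
      refine Tendsto.const_mul _ (Real.tendsto_exp_atBot.comp ?_)
      have h1 : Tendsto (fun n => (D n)⁻¹) atTop atTop :=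
        (tendsto_nhdsWithin_iff.2 ⟨hDlim, Eventually.of_forall hD0⟩).inv_tendsto_nhdsGT_zero
      have h2 : Tendsto (fun n => (-η ^ 2 / 2) * (D n)⁻¹) atTop atBot :=
        h1.const_mul_atTop_of_neg (by nlinarith)
      refine h2.congr fun n => ?_
      have := (hD0 n).ne'
      field_simp
    exact le_antisymm (ge_of_tendsto' hlim hle) zero_le
  calc P {ω | ∃ t ∈ S, t.1 < 1 ∧ t.2 < 1 ∧ x < |Y t ω|}
      ≤ P (Bad ∪ ⋃ t ∈ S ∩ {t | t.1 < 1 ∧ t.2 < 1}, (Badᶜ ∩ {ω | x < |Y t ω|})) := by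
        refine measure_mono ?_
        rintro ω ⟨t, htS, ht1, ht2, hx⟩
        by_cases hω : ω ∈ Bad
        · exact Or.inl hω
        · exact Or.inr (Set.mem_biUnion ⟨htS, ht1, ht2⟩ ⟨hω, hx⟩)
    _ ≤ P Bad + P (⋃ t ∈ S ∩ {t | t.1 < 1 ∧ t.2 < 1}, (Badᶜ ∩ {ω | x < |Y t ω|})) :=
        measure_union_le _ _
    _ = P Bad := by
        rw [(measure_biUnion_null_iff (hS.mono Set.inter_subset_left)).2
          fun t ht => hnull t ht.2.1 ht.2.2, add_zero]
    _ ≤ P B0 + ∑' n, P (B n) :=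
        (measure_union_le _ _).trans (add_le_add le_rfl (measure_iUnion_le _))
    _ ≤ _ := add_le_add hPB0 (ENNReal.tsum_le_tsum hPB)

/-! ### Choice of constants and the tail on the unit square. -/

/-- If `8√2 (ey)^(2/H) exp(-3y/(2a)) < 1` then both `y` and the exponent are large. -/
lemma exponent_bounds_of_lt_one {H a y : ℝ} (hH0 : 0 < H) (hH1 : H < 1) (ha : 4 < a)
    (hy : 8 / 3 * a < y)
    (hlt : 8 * √2 * (Real.exp 1 * y) ^ (2 / H) * Real.exp (-(3 * y / (2 * a))) < 1) :
    26 < y ∧ 2 + 8 / H < 3 * y / (2 * a) := by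
  have he1 := Real.exp_one_lt_d9
  have he0 := Real.exp_one_gt_d9
  have hy0 : 0 < y := by linarith
  set s := 3 * y / (2 * a) with hs
  have hys : y = 2 * a * s / 3 := by rw [hs]; field_simp
  have hH : 1 < 1 / H := by rw [lt_div_iff₀ hH0]; linarith
  -- Logarithm of `hlt`, with `8√2 ≥ e²`.
  have key : 2 + 2 / H * (1 + Real.log y) < s := by
    have h1 : Real.exp 2 ≤ 8 * √2 := by
      have h2 : Real.exp 2 = Real.exp 1 ^ 2 := by rw [← Real.exp_nat_mul]; norm_num
      have h3 : (1 : ℝ) ≤ √2 := Real.one_le_sqrt.2 (by norm_num)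
      rw [h2]; nlinarith
    have h4 : (Real.exp 1 * y) ^ (2 / H) = Real.exp (2 / H * (1 + Real.log y)) := by
      rw [Real.rpow_def_of_pos (by positivity), Real.log_mul (by positivity) hy0.ne',
        Real.log_exp, mul_comm]
    rw [h4] at hlt
    have h5 : Real.exp (2 + 2 / H * (1 + Real.log y) + -s) < 1 := by
      rw [Real.exp_add, Real.exp_add]
      refine lt_of_le_of_lt ?_ hlt
      gcongr
    rw [Real.exp_lt_one_iff] at h5
    linarith
  -- Bootstrap: `y > 32/3 > e²` gives `s > 8`, hence `y = 2as/3 > 21 ≥ e³`, which gives `s > 2 + 8/H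
  -- > 10` and so `y > 26`.
  have hlog : ∀ k : ℕ, Real.exp 1 ^ k ≤ y → 2 + (2 + 2 * k) / H < s := by
    intro k hk
    have h1 : (k : ℝ) ≤ Real.log y := by
      rw [Real.le_log_iff_exp_le hy0, ← mul_one (k : ℝ), Real.exp_nat_mul]; exact hk
    have h2 : (2 + 2 * (k : ℝ)) / H ≤ 2 / H * (1 + Real.log y) := by
      rw [div_mul_eq_mul_div]; gcongr; linarith
    linarith
  have h2 := hlog 2 (by nlinarith)
  have h3 : (2 + 2 * ((2 : ℕ) : ℝ)) / H = 6 * (1 / H) := by push_cast; ring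
  rw [h3] at h2
  have h4 := hlog 3 (by
    have : Real.exp 1 ^ 3 ≤ 21 := by
      calc Real.exp 1 ^ 3 ≤ 2.72 ^ 3 := by gcongr; linarith
        _ ≤ 21 := by norm_num
    rw [hys]; nlinarith)
  have h5 : (2 + 2 * ((3 : ℕ) : ℝ)) / H = 8 / H := by push_cast; ring
  rw [h5] at h4
  refine ⟨?_, h4⟩
  have h6 : 8 / H = 8 * (1 / H) := by ring
  rw [hys]; nlinarith

/-- Number of points and mesh of the coarsest grid. -/
lemma floor_rpow_inv_bounds {H y : ℝ} (hH0 : 0 < H) (hH1 : H < 1) (hy : 26 < y) :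
    0 < ⌊(Real.exp 1 * y) ^ (1 / H)⌋₊ ∧
    (⌊(Real.exp 1 * y) ^ (1 / H)⌋₊ : ℝ) ^ 2 ≤ (Real.exp 1 * y) ^ (2 / H) ∧
    2 * y ≤ (⌊(Real.exp 1 * y) ^ (1 / H)⌋₊ : ℝ) ^ H := by
  have he0 := Real.exp_one_gt_d9
  have hy0 : 0 < y := by linarith
  have hH : 1 ≤ 1 / H := by rw [le_div_iff₀ hH0]; linarith
  set b := (Real.exp 1 * y) ^ (1 / H) with hb
  have hb0 : 0 < b := by positivity
  have hbH : b ^ H = Real.exp 1 * y := by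
    rw [hb, ← Real.rpow_mul (by positivity), one_div_mul_cancel hH0.ne', Real.rpow_one]
  have hb26 : 26 ≤ b := by
    calc (26 : ℝ) ≤ Real.exp 1 * y := by nlinarith
      _ = (Real.exp 1 * y) ^ (1 : ℝ) := (Real.rpow_one _).symm
      _ ≤ b := Real.rpow_le_rpow_of_exponent_le (by nlinarith) hH
  have hfl : b < ⌊b⌋₊ + 1 := Nat.lt_floor_add_one b
  have hfl34 : 3 / 4 * b ≤ ⌊b⌋₊ := by linarith
  refine ⟨?_, ?_, ?_⟩
  · rw [Nat.floor_pos]; linarith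
  · have : (Real.exp 1 * y) ^ (2 / H) = b ^ 2 := by
      rw [hb, ← Real.rpow_natCast, ← Real.rpow_mul (by positivity)]; congr 1; push_cast; ring
    rw [this]
    have := Nat.floor_le hb0.le
    gcongr
  -- Rounding down costs at most a factor `3/4`, and `3e/4 > 2`.
  · calc 2 * y ≤ 3 / 4 * (Real.exp 1 * y) := by nlinarith
      _ ≤ (3 / 4) ^ H * (Real.exp 1 * y) := by
        gcongr
        calc (3 / 4 : ℝ) = (3 / 4) ^ (1 : ℝ) := (Real.rpow_one _).symm
          _ ≤ (3 / 4) ^ H :=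
            Real.rpow_le_rpow_of_exponent_ge (by norm_num) (by norm_num) hH1.le
      _ = (3 / 4 * b) ^ H := by rw [Real.mul_rpow (by norm_num) hb0.le, hbH]
      _ ≤ _ := Real.rpow_le_rpow (by positivity) hfl34 hH0.le

/-- Refinement factor between consecutive grids. -/
lemma ceil_rpow_inv_bounds {H : ℝ} (hH0 : 0 < H) (hH1 : H < 1) :
    0 < ⌈(4 : ℝ) ^ (1 / H)⌉₊ ∧ (4 : ℝ) ≤ (⌈(4 : ℝ) ^ (1 / H)⌉₊ : ℝ) ^ H ∧
    (⌈(4 : ℝ) ^ (1 / H)⌉₊ : ℝ) ^ 2 ≤ Real.exp (4.16 / H) := by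
  have hH : 1 ≤ 1 / H := by rw [le_div_iff₀ hH0]; linarith
  have h4 : (0 : ℝ) < 4 ^ (1 / H) := by positivity
  refine ⟨Nat.ceil_pos.2 h4, ?_, ?_⟩
  · calc (4 : ℝ) = (4 ^ (1 / H)) ^ H := by
          rw [← Real.rpow_mul (by norm_num), one_div_mul_cancel hH0.ne', Real.rpow_one]
      _ ≤ _ := Real.rpow_le_rpow h4.le (Nat.le_ceil _) hH0.le
  · have h1 : (1 : ℝ) ≤ 4 ^ (1 / H) := Real.one_le_rpow (by norm_num) (by linarith)
    have h2 : (2 : ℝ) ≤ 2 ^ (1 / H) := by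
      calc (2 : ℝ) = 2 ^ (1 : ℝ) := (Real.rpow_one _).symm
        _ ≤ _ := Real.rpow_le_rpow_of_exponent_le (by norm_num) hH
    -- Rounding up at most doubles, and `2 ≤ 2^(1/H)`; the square is then at most `64^(1/H)`, with
    -- `6 log 2 < 4.16`.
    have h3 : (⌈(4 : ℝ) ^ (1 / H)⌉₊ : ℝ) ≤ 2 ^ (1 / H) * 4 ^ (1 / H) := by
      have := Nat.ceil_lt_add_one h4.le
      nlinarith
    have h5 : (2 : ℝ) ^ (1 / H) * 4 ^ (1 / H) = Real.exp (3 * Real.log 2 / H) := by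
      rw [← Real.mul_rpow (by norm_num) (by norm_num), Real.rpow_def_of_pos (by norm_num)]
      rw [show (2 : ℝ) * 4 = 2 ^ 3 by norm_num, Real.log_pow]
      congr 1; push_cast; ring
    calc (⌈(4 : ℝ) ^ (1 / H)⌉₊ : ℝ) ^ 2 ≤ (Real.exp (3 * Real.log 2 / H)) ^ 2 := by
          rw [← h5]; gcongr
      _ = Real.exp (6 * Real.log 2 / H) := by rw [← Real.exp_nat_mul]; congr 1; push_cast; ring
      _ ≤ _ := by
        rw [Real.exp_le_exp]
        gcongr
        linarith [Real.log_two_lt_d9]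

/-- Tail of the supremum of a Gaussian field on the unit square whose increments are dominated by
those of a fractional Brownian sheet. -/
lemma measure_exists_lt_abs_le {Ω : Type*} [MeasurableSpace Ω] {P : Measure Ω}
    [IsProbabilityMeasure P] {Y : ℝ≥0 × ℝ≥0 → Ω → ℝ} (hY : IsGaussianProcess Y P)
    (hcent : ∀ t, ∫ ω, Y t ω ∂P = 0)
    (hvar : ∀ t : ℝ≥0 × ℝ≥0, t.1 < 1 → t.2 < 1 → ∫ ω, Y t ω ^ 2 ∂P ≤ 1)
    {H : ℝ} (hH0 : 0 < H) (hH1 : H < 1)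
    (hinc : ∀ δ : ℝ, 0 < δ → δ ≤ 1 → ∀ s t : ℝ≥0 × ℝ≥0, t.1 < 1 → t.2 < 1 → s.1 ≤ t.1 →
      s.2 ≤ t.2 → (t.1 : ℝ) - s.1 ≤ δ → (t.2 : ℝ) - s.2 ≤ δ →
      ∫ ω, (Y t ω - Y s ω) ^ 2 ∂P ≤ 4 * (δ ^ H) ^ 2)
    {S : Set (ℝ≥0 × ℝ≥0)} (hS : S.Countable) {a x : ℝ} (ha : 4 < a) (hx0 : 0 < x)
    (hx : 8 / 3 * a < x ^ 2) :
    P {ω | ∃ t ∈ S, t.1 < 1 ∧ t.2 < 1 ∧ x < |Y t ω|} ≤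
      ENNReal.ofReal (8 * √2 * (Real.exp 1 * x ^ 2) ^ (2 / H) *
        Real.exp (-(3 * x ^ 2 / (2 * a)))) := by
  -- A bound of 1 or more is trivial; otherwise its smallness forces `x²` to be large.
  by_cases htriv : 8 * √2 * (Real.exp 1 * x ^ 2) ^ (2 / H) *
        Real.exp (-(3 * x ^ 2 / (2 * a))) < 1
  swap
  · refine prob_le_one.trans ?_
    rw [← ENNReal.ofReal_one]
    exact ENNReal.ofReal_le_ofReal (not_lt.1 htriv)
  obtain ⟨hy, hs⟩ := exponent_bounds_of_lt_one hH0 hH1 ha hx htriv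
  have hs' : 3 * x ^ 2 / (2 * a) ≤ 3 / 8 * x ^ 2 := by
    rw [div_le_iff₀ (by linarith)]
    nlinarith
  set y := x ^ 2 with hydef
  set s := 3 * y / (2 * a) with hsdef
  set B := (Real.exp 1 * y) ^ (2 / H) with hBdef
  have hy0 : 0 < y := by positivity
  have hB0 : 0 < B := by positivity
  obtain ⟨hm0, hm0B, hm0H⟩ := floor_rpow_inv_bounds hH0 hH1 hy
  obtain ⟨hq0, hqH, hqE⟩ := ceil_rpow_inv_bounds hH0 hH1
  set m0 := ⌊(Real.exp 1 * y) ^ (1 / H)⌋₊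
  set q := ⌈(4 : ℝ) ^ (1 / H)⌉₊
  set m : ℕ → ℕ := fun n => m0 * q ^ n with hmdef
  have hm : ∀ n, 0 < m n := fun n => by positivity
  have hmH : ∀ n, 2 * y * 4 ^ n ≤ (m n : ℝ) ^ H := by
    intro n
    simp only [hmdef]
    push_cast
    rw [Real.mul_rpow (by positivity) (by positivity), ← Real.rpow_pow_comm (by positivity)]
    gcongr
  have hmE : ∀ n, (m n : ℝ) ^ 2 ≤ B * Real.exp (n * (4.16 / H)) := by
    intro n
    simp only [hmdef]
    push_cast
    rw [mul_pow, ← pow_mul, mul_comm n 2, pow_mul, Real.exp_nat_mul]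
    gcongr
  -- `D n = 4 / (2y·4^n)²` comes from `hmH`. The thresholds sum to at most `x/8`, leaving `7x/8` for
  -- the coarsest grid, where `(7/8)²/2 = 49/128 > 3/8`.
  have hgrid := measure_exists_lt_abs_le_of_grids hY hcent hvar (m := m) (q := q) hm hq0
    (fun n => by simp only [hmdef]; ring) (D := fun n => (y ^ 2 * 16 ^ n)⁻¹)
    (r := fun n => x / 16 * (1 / 2) ^ n) (R := x / 8) (x := x) (fun n => by positivity)
    (by
      refine Tendsto.inv_tendsto_atTop ?_
      exact (tendsto_pow_atTop_atTop_of_one_lt (by norm_num)).const_mul_atTop (by positivity))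
    (by
      intro n s t ht1 ht2 h1 h2 h3 h4
      have hmn : (1 : ℝ) ≤ m n := by exact_mod_cast hm n
      refine (hinc (1 / m n) (by positivity) ?_ s t ht1 ht2 h1 h2 h3 h4).trans ?_
      · rw [div_le_one (by linarith)]; exact hmn
      · rw [Real.div_rpow (by norm_num) (by linarith), Real.one_rpow, div_pow, one_pow,
          mul_one_div, div_le_iff₀ (by positivity), inv_mul_eq_div, le_div_iff₀ (by positivity)]
        calc 4 * (y ^ 2 * 16 ^ n) = (2 * y * 4 ^ n) ^ 2 := by
              have h16 : (16 : ℝ) ^ n = (4 ^ n) ^ 2 := by rw [pow_right_comm]; norm_num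
              rw [h16, mul_pow, mul_pow]; norm_num; ring
          _ ≤ _ := by gcongr; exact hmH n)
    (fun n => by positivity)
    (fun n => by
      rw [← Finset.mul_sum]
      nlinarith [sum_geometric_two_le n])
    (by linarith) hS
  refine hgrid.trans ?_
  have hfirst : (m 0 : ℝ) ^ 2 * (2 * Real.exp (-(x - x / 8) ^ 2 / (2 * 1))) ≤
      2 * B * Real.exp (-s) := by
    have h1 : Real.exp (-(x - x / 8) ^ 2 / (2 * 1)) ≤ Real.exp (-s) := by
      rw [Real.exp_le_exp]; nlinarith
    have h2 : (m 0 : ℝ) ^ 2 ≤ B := by simpa [hmdef] using hm0B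
    calc _ ≤ B * (2 * Real.exp (-s)) := by gcongr
      _ = _ := by ring
  have hterm : ∀ n, (m (n + 1) : ℝ) ^ 2 *
      (2 * Real.exp (-(x / 16 * (1 / 2) ^ n) ^ 2 / (2 * (y ^ 2 * 16 ^ n)⁻¹))) ≤
      B * Real.exp (-s) * (1 / 2) ^ n := by
    intro n
    have h1 : -(x / 16 * (1 / 2) ^ n) ^ 2 / (2 * (y ^ 2 * 16 ^ n)⁻¹) = -(y ^ 3 / 512 * 4 ^ n) := by
      have h16 : (16 : ℝ) ^ n = 4 ^ n * (2 ^ n) ^ 2 := by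
        rw [← pow_mul, mul_comm n 2, pow_mul, ← mul_pow]; norm_num
      have h2 : (x / 16 * (1 / 2) ^ n) ^ 2 = y / 256 / (2 ^ n) ^ 2 := by
        rw [hydef, one_div, inv_pow]; ring
      rw [h2, h16]
      field_simp
      ring
    have hH8 : 4.16 / H ≤ 0.2 * y := by
      have : 4.16 / H = 0.52 * (8 / H) := by ring
      rw [this]; linarith
    have h4n : (n : ℝ) + 1 ≤ 4 ^ n := by
      have := one_add_mul_le_pow (show (-2 : ℝ) ≤ 3 by norm_num) n
      have hn : (0 : ℝ) ≤ n := n.cast_nonneg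
      norm_num at this
      linarith
    have hcube : 1.3 * y ≤ y ^ 3 / 512 := by
      rw [le_div_iff₀ (by norm_num)]
      nlinarith [mul_pos hy0 hy0, mul_lt_mul'' hy hy (by norm_num) (by norm_num)]
    -- In units of `(n + 1) * y`, the gain is at least `1.3`, while grid size, `s` and the `log 2`
    -- terms cost at most `0.2`, `3/8` and `0.1` (plus `0.1` for the geometric factor).
    have hexp : ((n + 1 : ℕ) : ℝ) * (4.16 / H) + Real.log 2 + -(y ^ 3 / 512 * 4 ^ n) ≤
        -s - n * Real.log 2 := by
      push_cast
      have hl := Real.log_two_lt_d9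
      have hn : (0 : ℝ) ≤ n := n.cast_nonneg
      have e1 : ((n : ℝ) + 1) * (1.3 * y) ≤ y ^ 3 / 512 * 4 ^ n := by
        rw [mul_comm]; gcongr
      have e2 : ((n : ℝ) + 1) * (4.16 / H) ≤ ((n : ℝ) + 1) * (0.2 * y) := by gcongr
      have e3 : s ≤ ((n : ℝ) + 1) * (3 / 8 * y) := by nlinarith
      have e4 : ((n : ℝ) + 1) * Real.log 2 ≤ ((n : ℝ) + 1) * (0.1 * y) := by
        gcongr; linarith
      nlinarith [mul_nonneg hn hy0.le]
    rw [h1]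
    calc (m (n + 1) : ℝ) ^ 2 * (2 * Real.exp (-(y ^ 3 / 512 * 4 ^ n)))
        ≤ (B * Real.exp ((n + 1 : ℕ) * (4.16 / H))) *
            (2 * Real.exp (-(y ^ 3 / 512 * 4 ^ n))) := by
          gcongr; exact hmE (n + 1)
      _ = B * Real.exp (((n + 1 : ℕ) : ℝ) * (4.16 / H) + Real.log 2 +
            -(y ^ 3 / 512 * 4 ^ n)) := by
          rw [Real.exp_add, Real.exp_add, Real.exp_log (by norm_num)]; ring
      _ ≤ B * Real.exp (-s - n * Real.log 2) := by gcongr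
      _ = _ := by
          rw [Real.exp_sub, Real.exp_nat_mul, Real.exp_log (by norm_num), one_div, inv_pow]
          field_simp
  have htail : ∑' n, ENNReal.ofReal ((m (n + 1) : ℝ) ^ 2 *
      (2 * Real.exp (-(x / 16 * (1 / 2) ^ n) ^ 2 / (2 * (y ^ 2 * 16 ^ n)⁻¹)))) ≤
      ENNReal.ofReal (2 * B * Real.exp (-s)) := by
    calc _ ≤ ∑' n : ℕ, ENNReal.ofReal (B * Real.exp (-s) * (1 / 2) ^ n) :=
          ENNReal.tsum_le_tsum fun n => ENNReal.ofReal_le_ofReal (hterm n)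
      _ = ENNReal.ofReal (∑' n : ℕ, B * Real.exp (-s) * (1 / 2) ^ n) :=
          (ENNReal.ofReal_tsum_of_nonneg (fun n => by positivity)
            (summable_geometric_two.mul_left _)).symm
      _ = _ := by rw [tsum_mul_left, tsum_geometric_two]; congr 1; ring
  calc _ ≤ ENNReal.ofReal (2 * B * Real.exp (-s)) + ENNReal.ofReal (2 * B * Real.exp (-s)) :=
        add_le_add (ENNReal.ofReal_le_ofReal hfirst) htail
    _ = ENNReal.ofReal (4 * (B * Real.exp (-s))) := by
        rw [← ENNReal.ofReal_add (by positivity) (by positivity)]; congr 1; ring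
    _ ≤ _ := by
        refine ENNReal.ofReal_le_ofReal ?_
        rw [mul_assoc (8 * √2)]
        have h3 : (1 : ℝ) ≤ √2 := Real.one_le_sqrt.2 (by norm_num)
        gcongr
        linarith

/-! ### Second moments of the field and of its increments. -/

lemma EqFinDimDistrib.identDistrib_eval {Ω T : Type*} [MeasurableSpace Ω] {P : Measure Ω}
    {X Y : T → Ω → ℝ} (h : EqFinDimDistrib P X Y) (t : T) :
    IdentDistrib (X t) (Y t) P P :=
  (h {t}).comp (u := fun f : ({t} : Finset T) → ℝ => f ⟨t, Finset.mem_singleton_self t⟩)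
    (measurable_pi_apply _)

lemma EqFinDimDistrib.integral_sq_eq {Ω T : Type*} [MeasurableSpace Ω] {P : Measure Ω}
    {X Y : T → Ω → ℝ} (h : EqFinDimDistrib P X Y) (t : T) :
    ∫ ω, X t ω ^ 2 ∂P = ∫ ω, Y t ω ^ 2 ∂P :=
  (h.identDistrib_eval t).sq.integral_eq

lemma rpow_sq_gt_one {H : ℝ} (hH : 0 < H) : 1 < ((2 : ℝ) ^ H) ^ 2 :=
  one_lt_pow₀ (Real.one_lt_rpow one_lt_two hH) two_ne_zero

/-- Second moments of a self-similar field. -/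
lemma IsSelfSimilarField.integral_sq {Ω : Type*} [MeasurableSpace Ω] {P : Measure Ω}
    {X : ℝ≥0 × ℝ≥0 → Ω → ℝ} {H₁ H₂ : ℝ} (hself : IsSelfSimilarField P X H₁ H₂)
    (hH₁ : 0 < H₁) (hH₂ : 0 < H₂) (hvar : ∫ ω, X (1, 1) ω ^ 2 ∂P = 1) (t : ℝ≥0 × ℝ≥0) :
    ∫ ω, X t ω ^ 2 ∂P = ((t.1 : ℝ) ^ H₁ * (t.2 : ℝ) ^ H₂) ^ 2 := by
  obtain ⟨t₁, t₂⟩ := t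
  rcases eq_or_ne t₁ 0 with rfl | h₁
  -- A point on an axis is fixed by doubling its zero coordinate, yet its second moment is
  -- multiplied by `(2^H₁)² > 1`, so it is 0.
  · have h := (hself 2 1 two_pos one_pos).integral_sq_eq (0, t₂)
    simp only [mul_zero, one_mul, NNReal.coe_one, Real.one_rpow, mul_one, mul_pow,
      integral_const_mul, NNReal.coe_ofNat] at h
    simp only [NNReal.coe_zero, Real.zero_rpow hH₁.ne', zero_mul]
    nlinarith [rpow_sq_gt_one hH₁]
  rcases eq_or_ne t₂ 0 with rfl | h₂
  · have h := (hself 1 2 one_pos two_pos).integral_sq_eq (t₁, 0)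
    simp only [mul_zero, one_mul, NNReal.coe_one, Real.one_rpow, mul_pow,
      integral_const_mul, NNReal.coe_ofNat] at h
    simp only [NNReal.coe_zero, Real.zero_rpow hH₂.ne', mul_zero]
    nlinarith [rpow_sq_gt_one hH₂]
  · have h := (hself t₁ t₂ (pos_iff_ne_zero.2 h₁) (pos_iff_ne_zero.2 h₂)).integral_sq_eq (1, 1)
    simp only [mul_one] at h
    rw [h]
    simp only [mul_pow _ (X (1, 1) _), integral_const_mul, hvar, mul_one]

/-- The hypotheses on the field `X` used for moment computations. -/
structure IsUnitGaussianSheet {Ω : Type*} [MeasurableSpace Ω] (P : Measure Ω)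
    (X : ℝ≥0 × ℝ≥0 → Ω → ℝ) (H₁ H₂ : ℝ) : Prop where
  pos₁ : 0 < H₁
  pos₂ : 0 < H₂
  gauss : IsGaussianProcess X P
  cent : ∀ t, ∫ ω, X t ω ∂P = 0
  var_one : ∫ ω, X (1, 1) ω ^ 2 ∂P = 1
  selfSimilar : IsSelfSimilarField P X H₁ H₂
  incr : HasStationaryRectIncrements P X

namespace IsUnitGaussianSheet

variable {Ω : Type*} [MeasurableSpace Ω] {P : Measure Ω} {X : ℝ≥0 × ℝ≥0 → Ω → ℝ} {H₁ H₂ : ℝ}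

lemma integral_sq (h : IsUnitGaussianSheet P X H₁ H₂) (t : ℝ≥0 × ℝ≥0) :
    ∫ ω, X t ω ^ 2 ∂P = ((t.1 : ℝ) ^ H₁ * (t.2 : ℝ) ^ H₂) ^ 2 :=
  h.selfSimilar.integral_sq h.pos₁ h.pos₂ h.var_one t

/-- Hence a rectangular increment with its base corner on an axis is a.s. an ordinary increment in
one coordinate. -/
lemma ae_eq_zero (h : IsUnitGaussianSheet P X H₁ H₂) {t : ℝ≥0 × ℝ≥0} (ht : t.1 = 0 ∨ t.2 = 0) :
    ∀ᵐ ω ∂P, X t ω = 0 := by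
  have h0 : ∫ ω, X t ω ^ 2 ∂P = 0 := by
    rw [h.integral_sq]
    rcases ht with ht | ht
    · simp [ht, Real.zero_rpow h.pos₁.ne']
    · simp [ht, Real.zero_rpow h.pos₂.ne']
  rw [integral_eq_zero_iff_of_nonneg (fun ω => sq_nonneg _)
    (h.gauss.hasGaussianLaw_eval t).memLp_two.integrable_sq] at h0
  filter_upwards [h0] with ω hω
  simpa using hω

lemma integral_rectIncrement_sq (h : IsUnitGaussianSheet P X H₁ H₂) (u d : ℝ≥0 × ℝ≥0) :
    ∫ ω, rectIncrement X u (u + d) ω ^ 2 ∂P = ((d.1 : ℝ) ^ H₁ * (d.2 : ℝ) ^ H₂) ^ 2 := by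
  rw [(h.incr u).integral_sq_eq d, ← h.integral_sq d]
  refine integral_congr_ae ?_
  filter_upwards [h.ae_eq_zero (t := (0, d.2)) (Or.inl rfl),
    h.ae_eq_zero (t := (d.1, 0)) (Or.inr rfl), h.ae_eq_zero (t := (0, 0)) (Or.inl rfl)]
    with ω h1 h2 h3
  simp only [rectIncrement, Prod.fst_zero, Prod.snd_zero, h1, h2, h3, sub_zero, add_zero]

lemma integral_fst_sub_sq (h : IsUnitGaussianSheet P X H₁ H₂) (s d w : ℝ≥0) :
    ∫ ω, (X (s + d, w) ω - X (s, w) ω) ^ 2 ∂P = ((d : ℝ) ^ H₁ * (w : ℝ) ^ H₂) ^ 2 := by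
  rw [← h.integral_rectIncrement_sq (s, 0) (d, w)]
  refine integral_congr_ae ?_
  filter_upwards [h.ae_eq_zero (t := (s + d, 0)) (Or.inr rfl),
    h.ae_eq_zero (t := (s, 0)) (Or.inr rfl)] with ω h1 h2
  simp [rectIncrement, h1, h2]

lemma integral_snd_sub_sq (h : IsUnitGaussianSheet P X H₁ H₂) (s d w : ℝ≥0) :
    ∫ ω, (X (w, s + d) ω - X (w, s) ω) ^ 2 ∂P = ((w : ℝ) ^ H₁ * (d : ℝ) ^ H₂) ^ 2 := by
  rw [← h.integral_rectIncrement_sq (0, s) (w, d)]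
  refine integral_congr_ae ?_
  filter_upwards [h.ae_eq_zero (t := (0, s + d)) (Or.inl rfl),
    h.ae_eq_zero (t := (0, s)) (Or.inl rfl)] with ω h1 h2
  simp [rectIncrement, h1, h2]

/-- Go from `s` to `t` through the corner `(s₁, t₂)` and use `(p + q)² ≤ 2p² + 2q²`. -/
lemma integral_sub_sq_le (h : IsUnitGaussianSheet P X H₁ H₂) {s t : ℝ≥0 × ℝ≥0}
    (h1 : s.1 ≤ t.1) (h2 : s.2 ≤ t.2) :
    ∫ ω, (X t ω - X s ω) ^ 2 ∂P ≤
      2 * (((t.1 : ℝ) - s.1) ^ H₁ * (t.2 : ℝ) ^ H₂) ^ 2 +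
      2 * ((s.1 : ℝ) ^ H₁ * ((t.2 : ℝ) - s.2) ^ H₂) ^ 2 := by
  obtain ⟨s₁, s₂⟩ := s
  obtain ⟨t₁, t₂⟩ := t
  simp only at h1 h2 ⊢
  have e1 := h.integral_fst_sub_sq s₁ (t₁ - s₁) t₂
  have e2 := h.integral_snd_sub_sq s₂ (t₂ - s₂) s₁
  rw [add_tsub_cancel_of_le h1, NNReal.coe_sub h1] at e1
  rw [add_tsub_cancel_of_le h2, NNReal.coe_sub h2] at e2
  have hint : ∀ s t, Integrable (fun ω => (X t ω - X s ω) ^ 2) P := fun s t =>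
    (h.gauss.hasGaussianLaw_fun_sub).memLp_two.integrable_sq
  rw [← e1, ← e2, ← integral_const_mul, ← integral_const_mul,
    ← integral_add ((hint _ _).const_mul 2) ((hint _ _).const_mul 2)]
  refine integral_mono (hint _ _) (((hint _ _).const_mul 2).add ((hint _ _).const_mul 2))
    fun ω => ?_
  simp only
  nlinarith [sq_nonneg ((X (t₁, t₂) ω - X (s₁, t₂) ω) - (X (s₁, t₂) ω - X (s₁, s₂) ω))]

/-! ### Tail on a square of arbitrary side. -/

/-- Tail of the supremum over the square `[0,T)²`, along a countable set. -/
lemma measure_exists_mem_lt_abs_le [IsProbabilityMeasure P] (h : IsUnitGaussianSheet P X H₁ H₂)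
    {H : ℝ} (hH0 : 0 < H) (hH1 : H < 1) (hHH₁ : H ≤ H₁) (hHH₂ : H ≤ H₂)
    {S : Set (ℝ≥0 × ℝ≥0)} (hS : S.Countable) {T : ℝ≥0} (hT : 0 < T) {a x : ℝ} (ha : 4 < a)
    (hx0 : 0 < x) (hx : 8 / 3 * a < x ^ 2) :
    P {ω | ∃ t ∈ S, t.1 < T ∧ t.2 < T ∧ x * (T : ℝ) ^ (H₁ + H₂) < |X t ω|} ≤
      ENNReal.ofReal (8 * √2 * (Real.exp 1 * x ^ 2) ^ (2 / H) *
        Real.exp (-(3 * x ^ 2 / (2 * a)))) := by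
  have hT' : (0 : ℝ) < T := hT
  set K : ℝ := (T : ℝ) ^ (H₁ + H₂) with hK
  have hK0 : 0 < K := by positivity
  have hKmul : K = (T : ℝ) ^ H₁ * (T : ℝ) ^ H₂ := Real.rpow_add hT' _ _
  set Y : ℝ≥0 × ℝ≥0 → Ω → ℝ := fun t ω => K⁻¹ * X (T * t.1, T * t.2) ω with hYdef
  have hY : IsGaussianProcess Y P :=
    (h.gauss.comp_right fun t : ℝ≥0 × ℝ≥0 => (T * t.1, T * t.2)).smul fun _ => K⁻¹
  have hscale : ∀ d w : ℝ, 0 ≤ d → 0 ≤ w →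
      (K⁻¹) ^ 2 * ((T * d) ^ H₁ * (T * w) ^ H₂) ^ 2 = (d ^ H₁ * w ^ H₂) ^ 2 := by
    intro d w hd hw
    rw [Real.mul_rpow hT'.le hd, Real.mul_rpow hT'.le hw, ← mul_pow, hKmul]
    have : (T : ℝ) ^ H₁ ≠ 0 := by positivity
    have : (T : ℝ) ^ H₂ ≠ 0 := by positivity
    congr 1
    field_simp
  have hle1 : ∀ (w : ℝ≥0) (p : ℝ), 0 < p → w < 1 → (w : ℝ) ^ p ≤ 1 := fun w p hp hw =>
    Real.rpow_le_one w.coe_nonneg (by exact_mod_cast hw.le) hp.le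
  have hbound := measure_exists_lt_abs_le hY (H := H) (a := a) (x := x)
    (fun t => by simp only [hYdef, integral_const_mul, h.cent, mul_zero])
    (fun t ht1 ht2 => by
      simp only [hYdef, mul_pow, integral_const_mul]
      rw [h.integral_sq]
      push_cast
      rw [hscale _ _ t.1.coe_nonneg t.2.coe_nonneg]
      refine pow_le_one₀ (by positivity) (mul_le_one₀ (hle1 _ _ h.pos₁ ht1) (by positivity)
        (hle1 _ _ h.pos₂ ht2)))
    hH0 hH1
    (by
      intro δ hδ0 hδ1 s t ht1 ht2 h1 h2 h3 h4
      have h1' : (s.1 : ℝ) ≤ t.1 := h1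
      have h2' : (s.2 : ℝ) ≤ t.2 := h2
      simp only [hYdef, ← mul_sub, mul_pow, integral_const_mul]
      have h5 := h.integral_sub_sq_le (s := (T * s.1, T * s.2)) (t := (T * t.1, T * t.2))
        (mul_le_mul_of_nonneg_left h1 zero_le) (mul_le_mul_of_nonneg_left h2 zero_le)
      simp only [NNReal.coe_mul, ← mul_sub] at h5
      -- Since `δ ≤ 1`, both exponents may be lowered to `H`.
      have hδ : ∀ (d p : ℝ), 0 ≤ d → d ≤ δ → H ≤ p → d ^ p ≤ δ ^ H := fun d p hd hdδ hp =>
        (Real.rpow_le_rpow hd hdδ (hH0.le.trans hp)).trans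
          (Real.rpow_le_rpow_of_exponent_ge hδ0 hδ1 hp)
      have b1 : ((t.1 : ℝ) - s.1) ^ H₁ * (t.2 : ℝ) ^ H₂ ≤ δ ^ H := by
        exact (mul_le_of_le_one_right (Real.rpow_nonneg (sub_nonneg.2 h1') _)
          (hle1 _ _ h.pos₂ ht2)).trans (hδ _ _ (sub_nonneg.2 h1') h3 hHH₁)
      have b2 : (s.1 : ℝ) ^ H₁ * ((t.2 : ℝ) - s.2) ^ H₂ ≤ δ ^ H := by
        exact (mul_le_of_le_one_left (Real.rpow_nonneg (sub_nonneg.2 h2') _)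
          (hle1 _ _ h.pos₁ (h1.trans_lt ht1))).trans (hδ _ _ (sub_nonneg.2 h2') h4 hHH₂)
      have h6 := mul_le_mul_of_nonneg_left h5 (sq_nonneg K⁻¹)
      rw [mul_add, mul_left_comm _ (2 : ℝ), mul_left_comm _ (2 : ℝ),
        hscale _ _ (sub_nonneg.2 h1') t.2.coe_nonneg,
        hscale _ _ s.1.coe_nonneg (sub_nonneg.2 h2')] at h6
      refine h6.trans ?_
      have c1 := pow_le_pow_left₀ (mul_nonneg (Real.rpow_nonneg (sub_nonneg.2 h1') _)
        (Real.rpow_nonneg t.2.coe_nonneg _)) b1 2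
      have c2 := pow_le_pow_left₀ (mul_nonneg (Real.rpow_nonneg s.1.coe_nonneg _)
        (Real.rpow_nonneg (sub_nonneg.2 h2') _)) b2 2
      linarith)
    (hS.image fun t => (t.1 / T, t.2 / T)) ha hx0 hx
  refine (measure_mono ?_).trans hbound
  rintro ω ⟨t, htS, ht1, ht2, hx⟩
  refine ⟨_, Set.mem_image_of_mem _ htS, (div_lt_one hT).2 ht1, (div_lt_one hT).2 ht2, ?_⟩
  simp only [hYdef, mul_div_cancel₀ _ hT.ne', Prod.mk.eta]
  rw [abs_mul, abs_of_pos (inv_pos.2 hK0), inv_mul_eq_div, lt_div_iff₀ hK0]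
  exact hx

/-- Tail of the supremum over the square `[0,T)²` of a separable field. -/
lemma measure_exists_lt_abs_le [IsProbabilityMeasure P] (h : IsUnitGaussianSheet P X H₁ H₂)
    (hsep : IsSeparableField P X)
    {H : ℝ} (hH0 : 0 < H) (hH1 : H < 1) (hHH₁ : H ≤ H₁) (hHH₂ : H ≤ H₂)
    {T : ℝ≥0} (hT : 0 < T) {a x : ℝ} (ha : 4 < a) (hx0 : 0 < x) (hx : 8 / 3 * a < x ^ 2) :
    P {ω | ∃ t : ℝ≥0 × ℝ≥0, t.1 < T ∧ t.2 < T ∧ x * (T : ℝ) ^ (H₁ + H₂) < |X t ω|} ≤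
      ENNReal.ofReal (8 * √2 * (Real.exp 1 * x ^ 2) ^ (2 / H) *
        Real.exp (-(3 * x ^ 2 / (2 * a)))) := by
  obtain ⟨S, hS, -, N, hN, hsub⟩ := hsep
  set L := x * (T : ℝ) ^ (H₁ + H₂)
  -- `[0,T)²` is open in the quadrant, axes included, so separability applies to it directly.
  have hF := hsub (Set.Iio T ×ˢ Set.Iio T) (isOpen_Iio.prod isOpen_Iio) (Set.Icc (-L) L) isClosed_Icc
  refine (measure_mono (t := N ∪ {ω | ∃ t ∈ S, t.1 < T ∧ t.2 < T ∧ L < |X t ω|}) ?_).trans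
    ((measure_union_le _ _).trans ?_)
  · rintro ω ⟨t, ht1, ht2, hx⟩
    by_cases hω : ∃ t ∈ S, t.1 < T ∧ t.2 < T ∧ L < |X t ω|
    · exact Or.inr hω
    · push Not at hω
      refine Or.inl (hF ⟨fun t ht => abs_le.1 (hω t ht.2 ht.1.1 ht.1.2), fun hall => ?_⟩)
      exact absurd hx (not_lt.2 (abs_le.2 (hall t ⟨ht1, ht2⟩)))
  · rw [hN, zero_add]
    exact h.measure_exists_mem_lt_abs_le hH0 hH1 hHH₁ hHH₂ hS hT ha hx0 hx

end IsUnitGaussianSheet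

/-! ### Covering the quadrant by squares and summing the bounds. -/

/-- An unbounded sequence starting below `r` brackets it between consecutive terms. -/
lemma exists_le_lt_succ_of_tendsto {b : ℕ → ℝ} (hb : Tendsto b atTop atTop) {r : ℝ}
    (h0 : b 0 ≤ r) : ∃ k, b k ≤ r ∧ r < b (k + 1) := by
  classical
  have hex : ∃ n, r < b n := (hb.eventually_gt_atTop r).exists
  have hne : Nat.find hex ≠ 0 := fun h => absurd (h ▸ Nat.find_spec hex) (not_lt.2 h0)
  obtain ⟨k, hk⟩ := Nat.exists_eq_succ_of_ne_zero hne
  exact ⟨k, not_lt.1 (Nat.find_min hex (by omega)), by simpa [hk] using Nat.find_spec hex⟩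

/-- Applied to `1 / r`: the strict inequality on the left puts the point inside the half-open square
of side `1 / b k`. -/
lemma exists_lt_le_succ_of_tendsto {b : ℕ → ℝ} (hb : Tendsto b atTop atTop) {r : ℝ}
    (h0 : b 0 < r) : ∃ k, b k < r ∧ r ≤ b (k + 1) := by
  classical
  have hex : ∃ n, r ≤ b n := (hb.eventually_ge_atTop r).exists
  have hne : Nat.find hex ≠ 0 := fun h => absurd (h ▸ Nat.find_spec hex) (not_le.2 h0)
  obtain ⟨k, hk⟩ := Nat.exists_eq_succ_of_ne_zero hne
  exact ⟨k, not_le.1 (Nat.find_min hex (by omega)), by simpa [hk] using Nat.find_spec hex⟩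

/-- An exceedance of the normalized field is an exceedance on one of the squares of side `b (k+1)`
or `1 / b k`. -/
lemma setOf_lt_normalizedSup_subset {Ω : Type*} {X : ℝ≥0 × ℝ≥0 → Ω → ℝ} {H₁ H₂ : ℝ}
    (hH : 0 < H₁ + H₂) {c : ℝ → ℝ} (hcpos : ∀ t, 0 < t → 0 < c t)
    (hcmono : MonotoneOn c (Set.Ici 1)) (hcsymm : ∀ t, 1 ≤ t → c (1 / t) = c t)
    {b : ℕ → ℝ} (hb0 : b 0 = 1) (hb1 : ∀ k, 1 ≤ b k) (hblim : Tendsto b atTop atTop)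
    {ε : ℝ} (hε : 0 < ε) :
    {ω | (ε : EReal) < normalizedSup X H₁ H₂ c ω} ⊆
      ⋃ k, ({ω | ∃ t : ℝ≥0 × ℝ≥0, t.1 < (b (k + 1)).toNNReal ∧ t.2 < (b (k + 1)).toNNReal ∧
          ε * levelRatio H₁ H₂ c b k * ((b (k + 1)).toNNReal : ℝ) ^ (H₁ + H₂) < |X t ω|} ∪
        {ω | ∃ t : ℝ≥0 × ℝ≥0, t.1 < (1 / b k).toNNReal ∧ t.2 < (1 / b k).toNNReal ∧
          ε * levelRatio H₁ H₂ c b k * ((1 / b k).toNNReal : ℝ) ^ (H₁ + H₂) < |X t ω|}) := by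
  intro ω hω
  have hbp : ∀ k, 0 < b k := fun k => one_pos.trans_le (hb1 k)
  obtain ⟨⟨t, ht⟩, hlt⟩ := lt_iSup_iff.1 (show (ε : EReal) < normalizedSup X H₁ H₂ c ω from hω)
  rw [EReal.coe_lt_coe_iff] at hlt
  simp only at hlt
  set r : ℝ := max (t.1 : ℝ) t.2 with hr
  have hr0 : 0 < r := by
    rw [hr, lt_max_iff]
    by_contra! hcon
    exact ht (Prod.ext (le_antisymm (by exact_mod_cast hcon.1) zero_le)
      (le_antisymm (by exact_mod_cast hcon.2) zero_le))
  rw [lt_div_iff₀ (mul_pos (by positivity) (hcpos r hr0))] at hlt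
  have hmem : ∀ T : ℝ, r < T → t.1 < T.toNNReal ∧ t.2 < T.toNNReal := fun T hT =>
    ⟨Real.lt_toNNReal_iff_coe_lt.2 ((le_max_left _ _).trans_lt hT),
      Real.lt_toNNReal_iff_coe_lt.2 ((le_max_right _ _).trans_lt hT)⟩
  rcases le_or_gt 1 r with h1 | h1
  · obtain ⟨k, hk1, hk2⟩ := exists_le_lt_succ_of_tendsto hblim (hb0.trans_le h1)
    refine Set.mem_iUnion.2 ⟨k, Or.inl ⟨t, (hmem _ hk2).1, (hmem _ hk2).2, lt_of_le_of_lt ?_ hlt⟩⟩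
    rw [Real.coe_toNNReal _ (hbp _).le, levelRatio, Real.div_rpow (hbp _).le (hbp _).le]
    have h2 : b (k + 1) ^ (H₁ + H₂) ≠ 0 := (Real.rpow_pos_of_pos (hbp _) _).ne'
    calc ε * (b k ^ (H₁ + H₂) / b (k + 1) ^ (H₁ + H₂) * c (b k)) * b (k + 1) ^ (H₁ + H₂)
        = ε * (b k ^ (H₁ + H₂) * c (b k)) := by field_simp
      _ ≤ ε * (r ^ (H₁ + H₂) * c r) := by
        have := hbp k
        have := hcpos _ this
        gcongr
        exact hcmono (hb1 k) h1 hk1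
  -- Inversion `r ↦ 1/r` preserves `c` and swaps the shell's ends, so the same `levelRatio` appears,
  -- now against the side `1 / b k`.
  · have hr1 : 1 < 1 / r := (one_lt_div hr0).2 h1
    obtain ⟨k, hk1, hk2⟩ := exists_lt_le_succ_of_tendsto hblim (hb0.trans_lt hr1)
    have hk1' : r < 1 / b k := by rwa [lt_one_div hr0 (hbp k)]
    have hk2' : 1 / b (k + 1) ≤ r := by rwa [one_div_le (hbp _) hr0]
    refine Set.mem_iUnion.2 ⟨k, Or.inr ⟨t, (hmem _ hk1').1, (hmem _ hk1').2,
      lt_of_le_of_lt ?_ hlt⟩⟩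
    have hcr : c r = c (1 / r) := by rw [← hcsymm _ hr1.le, one_div_one_div]
    have h2 : b k ^ (H₁ + H₂) ≠ 0 := (Real.rpow_pos_of_pos (hbp _) _).ne'
    rw [Real.coe_toNNReal _ (one_div_pos.2 (hbp _)).le, levelRatio,
      Real.div_rpow (hbp _).le (hbp _).le, Real.div_rpow one_pos.le (hbp _).le, Real.one_rpow, hcr]
    calc ε * (b k ^ (H₁ + H₂) / b (k + 1) ^ (H₁ + H₂) * c (b k)) * (1 / b k ^ (H₁ + H₂))
        = ε * ((1 / b (k + 1)) ^ (H₁ + H₂) * c (b k)) := by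
          rw [Real.div_rpow one_pos.le (hbp _).le, Real.one_rpow]; field_simp
      _ ≤ ε * (r ^ (H₁ + H₂) * c (1 / r)) := by
        have := hbp (k + 1)
        have := hcpos _ (hbp k)
        gcongr
        exact hcmono (hb1 k) hr1.le hk1.le

/-- The bound on one square, in terms of the quantities of the theorem. -/
lemma tail_term_le {H a M ε v x : ℝ} (ha : 0 < a) (hM : 0 < M) (hε : 0 < ε) (hv : 2 ≤ v)
    (hx : x ^ 2 = ε ^ 2 * M ^ 2 * v / 2) (hu : 2 ≤ 3 / a * (M ^ 2 / 4) * ε ^ 2) :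
    2 * (8 * √2 * (Real.exp 1 * x ^ 2) ^ (2 / H) * Real.exp (-(3 * x ^ 2 / (2 * a)))) ≤
      16 * √2 * (Real.exp 1 / 2) ^ (2 / H) * ε ^ (4 / H) * (v ^ (2 / H) / Real.exp v) *
        M ^ (4 / H) * Real.exp (-(3 / a * (M ^ 2 / 4)) * ε ^ 2) := by
  set w := 3 / a * (M ^ 2 / 4) * ε ^ 2 with hw
  have hv0 : 0 < v := by linarith
  have hpow : ∀ z : ℝ, 0 < z → (z ^ 2) ^ (2 / H) = z ^ (4 / H) := fun z hz => by
    rw [← Real.rpow_natCast, ← Real.rpow_mul hz.le]; congr 1; push_cast; ring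
  have h1 : (Real.exp 1 * x ^ 2) ^ (2 / H) =
      (Real.exp 1 / 2) ^ (2 / H) * ε ^ (4 / H) * M ^ (4 / H) * v ^ (2 / H) := by
    rw [hx, show Real.exp 1 * (ε ^ 2 * M ^ 2 * v / 2) = Real.exp 1 / 2 * ε ^ 2 * M ^ 2 * v by ring,
      Real.mul_rpow (by positivity) hv0.le, Real.mul_rpow (by positivity) (by positivity),
      Real.mul_rpow (by positivity) (by positivity), hpow ε hε, hpow M hM]
  have h2 : 3 * x ^ 2 / (2 * a) = v * w := by rw [hx, hw]; field_simp; ring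
  -- For `v, w ≥ 2`, `(v - 1)(w - 1) ≥ 1`, that is `v + w ≤ v * w`.
  have h3 : Real.exp (-(v * w)) ≤ Real.exp (-v) * Real.exp (-w) := by
    rw [← Real.exp_add, Real.exp_le_exp]; nlinarith
  rw [h1, h2, neg_mul, ← hw, div_eq_mul_inv (v ^ (2 / H)), ← Real.exp_neg]
  calc _ = 16 * √2 * (Real.exp 1 / 2) ^ (2 / H) * ε ^ (4 / H) * M ^ (4 / H) * v ^ (2 / H) *
        Real.exp (-(v * w)) := by ring
    _ ≤ 16 * √2 * (Real.exp 1 / 2) ^ (2 / H) * ε ^ (4 / H) * M ^ (4 / H) * v ^ (2 / H) *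
        (Real.exp (-v) * Real.exp (-w)) := by gcongr
    _ = _ := by ring

theorem mainTheorem6 {Ω : Type*} [MeasurableSpace Ω] (P : Measure Ω) [IsProbabilityMeasure P]
    (X : ℝ≥0 × ℝ≥0 → Ω → ℝ) (H₁ H₂ : ℝ)
    (hH₁ : H₁ ∈ Set.Ioo (0 : ℝ) 1) (hH₂ : H₂ ∈ Set.Ioo (0 : ℝ) 1)
    (hgauss : IsGaussianProcess X P)
    (hcent : ∀ t, ∫ ω, X t ω ∂P = 0)
    (hvar : ∫ ω, (X (1, 1) ω) ^ 2 ∂P = 1)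
    (hsep : IsSeparableField P X)
    (hself : IsSelfSimilarField P X H₁ H₂)
    (hincr : HasStationaryRectIncrements P X)
    (c : ℝ → ℝ) (hcpos : ∀ t, 0 < t → 0 < c t)
    (hcmono : MonotoneOn c (Set.Ici 1)) (hclim : Tendsto c atTop atTop)
    (hcsymm : ∀ t, 1 ≤ t → c (1 / t) = c t)
    (b : ℕ → ℝ) (hb0 : b 0 = 1) (hbmono : ∀ n, b n < b (n + 1)) (hblim : Tendsto b atTop atTop)
    (H : ℝ) (hH : H = min H₁ H₂)
    (M : ℝ) (hM : M = ⨅ k, levelRatio H₁ H₂ c b k) (hMpos : 0 < M)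
    (u : ℝ) (hu : u = 3 / ((4 : ℝ) ^ (1 - H) + 3) * (M ^ 2 / 4))
    (v : ℕ → ℝ) (hv : ∀ k, v k = 2 / M ^ 2 * (levelRatio H₁ H₂ c b k) ^ 2)
    (hsum : Summable fun k => v k ^ (2 / H) / Real.exp (v k))
    (ε : ℝ) (hε : 2 / M * √(2 / 3 * ((4 : ℝ) ^ (1 - H) + 3)) < ε) :
    P {ω | (ε : EReal) < normalizedSup X H₁ H₂ c ω} ≤
      ENNReal.ofReal (16 * √2 * (Real.exp 1 / 2) ^ (2 / H) * ε ^ (4 / H) *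
        (∑' k, v k ^ (2 / H) / Real.exp (v k)) * M ^ (4 / H) * Real.exp (-u * ε ^ 2)) := by
  obtain ⟨hH₁0, hH₁1⟩ := hH₁
  obtain ⟨hH₂0, hH₂1⟩ := hH₂
  have hsheet : IsUnitGaussianSheet P X H₁ H₂ := ⟨hH₁0, hH₂0, hgauss, hcent, hvar, hself, hincr⟩
  have hH0 : 0 < H := hH ▸ lt_min hH₁0 hH₂0
  have hHH₁ : H ≤ H₁ := hH ▸ min_le_left _ _
  have hHH₂ : H ≤ H₂ := hH ▸ min_le_right _ _
  have hH1 : H < 1 := hHH₁.trans_lt hH₁1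
  set a := (4 : ℝ) ^ (1 - H) + 3 with ha
  have ha4 : 4 < a := by
    have : (1 : ℝ) < 4 ^ (1 - H) := Real.one_lt_rpow (by norm_num) (by linarith)
    linarith
  have hε0 : 0 < ε := lt_of_le_of_lt (by positivity) hε
  -- The threshold on `ε`, squared. It serves twice: as `x² > 8a/3` on each square (because `v k ≥
  -- 2`) and as `u ε² ≥ 2`.
  have hεM : 8 / 3 * a < ε ^ 2 * M ^ 2 := by
    have h1 : 2 * √(2 / 3 * a) < ε * M := by
      rwa [div_mul_eq_mul_div, div_lt_iff₀ hMpos] at hε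
    have h2 : (√(2 / 3 * a)) ^ 2 = 2 / 3 * a := Real.sq_sqrt (by positivity)
    have h3 : (2 * √(2 / 3 * a)) ^ 2 < (ε * M) ^ 2 := by gcongr
    nlinarith
  have hb1 : ∀ k, 1 ≤ b k := fun k => hb0 ▸ (strictMono_nat_of_lt_succ hbmono).monotone k.zero_le
  have hbp : ∀ k, 0 < b k := fun k => one_pos.trans_le (hb1 k)
  have hratio0 : ∀ k, 0 < levelRatio H₁ H₂ c b k := fun k =>
    mul_pos (Real.rpow_pos_of_pos (div_pos (hbp _) (hbp _)) _) (hcpos _ (hbp k))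
  have hMle : ∀ k, M ≤ levelRatio H₁ H₂ c b k := fun k =>
    hM ▸ ciInf_le ⟨0, by rintro _ ⟨j, rfl⟩; exact (hratio0 j).le⟩ k
  have hv2 : ∀ k, 2 ≤ v k := fun k => by
    rw [hv, div_mul_eq_mul_div, le_div_iff₀ (by positivity)]
    have := pow_le_pow_left₀ hMpos.le (hMle k) 2
    linarith
  have hx2 : ∀ k, (ε * levelRatio H₁ H₂ c b k) ^ 2 = ε ^ 2 * M ^ 2 * v k / 2 := fun k => by
    rw [hv]; field_simp
  have huε : 2 ≤ 3 / a * (M ^ 2 / 4) * ε ^ 2 := by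
    rw [div_mul_eq_mul_div, div_mul_eq_mul_div, le_div_iff₀ (by linarith)]
    nlinarith
  set C : ℕ → ℝ := fun k => 16 * √2 * (Real.exp 1 / 2) ^ (2 / H) * ε ^ (4 / H) *
    (v k ^ (2 / H) / Real.exp (v k)) * M ^ (4 / H) * Real.exp (-u * ε ^ 2) with hC
  have hC0 : ∀ k, 0 ≤ C k := fun k => by
    have := hv2 k
    have : 0 ≤ v k := by linarith
    positivity
  have hCeq : C = fun k => 16 * √2 * (Real.exp 1 / 2) ^ (2 / H) * ε ^ (4 / H) * M ^ (4 / H) *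
      Real.exp (-u * ε ^ 2) * (v k ^ (2 / H) / Real.exp (v k)) := by
    funext k; simp only [hC]; ring
  have hsquare : ∀ (k : ℕ) (T : ℝ≥0), 0 < T →
      P {ω | ∃ t : ℝ≥0 × ℝ≥0, t.1 < T ∧ t.2 < T ∧
        ε * levelRatio H₁ H₂ c b k * (T : ℝ) ^ (H₁ + H₂) < |X t ω|} ≤
      ENNReal.ofReal (C k / 2) := by
    intro k T hT
    refine (hsheet.measure_exists_lt_abs_le hsep hH0 hH1 hHH₁ hHH₂ hT ha4
      (mul_pos hε0 (hratio0 k)) ?_).trans (ENNReal.ofReal_le_ofReal ?_)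
    · have := hv2 k
      rw [hx2]
      nlinarith [mul_pos (pow_pos hε0 2) (pow_pos hMpos 2)]
    · have := tail_term_le (H := H) (by linarith) hMpos hε0 (hv2 k) (hx2 k) huε
      rw [← hu] at this
      linarith
  calc P {ω | (ε : EReal) < normalizedSup X H₁ H₂ c ω}
      ≤ ∑' k, ENNReal.ofReal (C k) := by
        refine (measure_mono (setOf_lt_normalizedSup_subset (by linarith) hcpos hcmono hcsymm hb0
          hb1 hblim hε0)).trans ((measure_iUnion_le _).trans (ENNReal.tsum_le_tsum fun k => ?_))
        refine (measure_union_le _ _).trans ((add_le_add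
          (hsquare k _ (Real.toNNReal_pos.2 (hbp _)))
          (hsquare k _ (Real.toNNReal_pos.2 (one_div_pos.2 (hbp _))))).trans_eq ?_)
        rw [← ENNReal.ofReal_add (by linarith [hC0 k]) (by linarith [hC0 k]), add_halves]
    _ = ENNReal.ofReal (∑' k, C k) :=
        (ENNReal.ofReal_tsum_of_nonneg hC0 (by rw [hCeq]; exact hsum.mul_left _)).symm
    _ = _ := by rw [hCeq, tsum_mul_left]; congr 1; ring
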